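/- Let $n,p\ge 1$ be integers, let $\Delta>0$, and let $\mathcal C=C([-\Delta,0],\mathbb R^n)$ carry the supremum norm $\|\cdot\|$ ($|\cdot|$ is the Euclidean norm on $\mathbb R^n$). Let $A_1,\dots,A_p\in\mathbb R^{n\times n}$, $0<\Delta_1,\dots,\Delta_p\le\Delta$, and $$\mathcal D\phi=\phi(0)-\sum_{j=1}^pA_j\,\phi(-\Delta_j),\qquad \phi\in\mathcal C .$$ Assume that $\mathcal D$ is strongly stable, i.e. for every choice of delays $r_1,\dots,r_p>0$ the zero solution of the difference equation $y(t)=\sum_{j}A_j\,y(t-r_j)$, $t\ge 0$ (with continuous solutions $y$), is uniformly asymptotically stable. Let $f:\mathcal C\to\mathbb R^n$ be globally Lipschitz with $f(0)=0$, and consider the neutral system $$\frac{d}{dt}\mathcal Dx_t=f(x_t),\quad t\ge 0,\qquad x_0=\xi_0\in\mathcal C,\qquad x_t(\tau)=x(t+\tau),\ \tau\in[-\Delta,0].$$ The system is called $0$-GES if there are $M,\lambda>0$ such that for every $\xi_0\in\mathcal C$ the solution exists for all $t\ge0$ and satisfies $|x(t)|\le Me^{-\lambda t}\|\xi_0\|$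 for all $t\ge 0$. For $V:\mathcal C\to[0,\infty)$ and $\phi\in\mathcal C$ put $$D^+V(\phi)=\limsup_{h\to0^+}\frac{V(\phi_h)-V(\phi)}{h}\in[-\infty,\infty],$$ where, for $0<h<\Delta$, $\phi_h(s)=\phi(s+h)$ for $s\in[-\Delta,-h]$ and $\phi_h(s)=\mathcal D\phi+(s+h)f(\phi)-\mathcal D\phi^\star_{s+h}+\phi(0)$ for $s\in(-h,0]$; here, for $0<\theta\le h$, $\phi^\star_\theta(s)=\phi(s+\theta)$ for $s\in[-\Delta,-\theta]$ and $\phi^\star_\theta(s)=\phi(0)$ for $s\in(-\theta,0]$. Then the system is $0$-GES if and only if there exist a globally Lipschitz functional $V:\mathcal C\to[0,\infty)$ and positive reals $a_1,a_2,a_3$ such that, for all $\phi\in\mathcal C$, (i) $a_1|\mathcal D\phi|\le V(\phi)\le a_2\|\phi\|$; (ii) $D^+V(\phi)\le -a_3V(\phi)$. -/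

import Mathlib

open Set Filter Topology
open scoped NNReal

/-- `ℝⁿ` with the Euclidean norm. -/
abbrev Vec (n : ℕ) : Type := EuclideanSpace ℝ (Fin n)

/-- The Banach space `𝒞` of continuous functions `[-Δ, 0] → ℝⁿ` with the supremum norm. -/
abbrev Hist (n : ℕ) (Δ : ℝ) : Type := C(Icc (-Δ) (0 : ℝ), Vec n)

/-- The data of a linear difference operator
`𝒟 φ = φ(0) - ∑ⱼ Aⱼ φ(-Δⱼ)` on `𝒞`, with maximal delay `Δ > 0` and delays `0 < Δⱼ ≤ Δ`. -/
structure DifferenceOperator (n p : ℕ) (Δ : ℝ) where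
  maxDelay_pos : 0 < Δ
  A : Fin p → Matrix (Fin n) (Fin n) ℝ
  delay : Fin p → ℝ
  delay_pos : ∀ j, 0 < delay j
  delay_le : ∀ j, delay j ≤ Δ

/-- The segment `x_t ∈ 𝒞`, `x_t(τ) = x(t + τ)`, of a continuous function `x : [-Δ, ∞) → ℝⁿ`.
It is only used for `t ≥ 0`, where the truncation `max (-Δ) _` has no effect
(see `histSegment_apply`). -/
noncomputable def histSegment {n : ℕ} {Δ : ℝ} (x : C(Ici (-Δ), Vec n)) (t : ℝ) : Hist n Δ where
  toFun τ := x ⟨max (-Δ) (t + τ), mem_Ici.2 (le_max_left _ _)⟩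
  continuous_toFun :=
    x.continuous.comp (Continuous.subtype_mk (by fun_prop) fun _ => mem_Ici.2 (le_max_left _ _))

theorem histSegment_apply {n : ℕ} {Δ : ℝ} (x : C(Ici (-Δ), Vec n)) {t : ℝ} (ht : 0 ≤ t)
    (τ : Icc (-Δ) (0 : ℝ)) :
    histSegment x t τ = x ⟨t + τ, by have := τ.2.1; simp only [mem_Ici]; linarith⟩ := by
  have h : -Δ ≤ t + τ := by have := τ.2.1; linarith
  simp [histSegment, max_eq_right h]

namespace DifferenceOperator

variable {n p : ℕ} {Δ : ℝ}

/-- The point `0` of `[-Δ, 0]`. -/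
def zeroPt (D : DifferenceOperator n p Δ) : Icc (-Δ) (0 : ℝ) :=
  ⟨0, by linarith [D.maxDelay_pos], le_rfl⟩

/-- The point `-Δⱼ` of `[-Δ, 0]`. -/
def delayPt (D : DifferenceOperator n p Δ) (j : Fin p) : Icc (-Δ) (0 : ℝ) :=
  ⟨-D.delay j, by linarith [D.delay_le j], by linarith [D.delay_pos j]⟩

/-- The operator itself: `𝒟 φ = φ(0) - ∑ⱼ Aⱼ φ(-Δⱼ)`. -/
noncomputable def map (D : DifferenceOperator n p Δ) (φ : Hist n Δ) : Vec n :=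
  φ D.zeroPt - ∑ j, Matrix.toEuclideanLin (D.A j) (φ (D.delayPt j))

/-- `y : [-Δ, ∞) → ℝⁿ` is a continuous solution of the homogeneous difference equation
`𝒟 y_t = 0`, `t ≥ 0` (in particular its initial segment lies in `{ψ | 𝒟 ψ = 0}`). -/
def IsHomogeneousSolution (D : DifferenceOperator n p Δ) (y : C(Ici (-Δ), Vec n)) : Prop :=
  ∀ t : ℝ, 0 ≤ t → D.map (histSegment y t) = 0

/-- `𝒟` is stable: the zero solution of `𝒟 y_t = 0`, `y_0 = ψ`, `𝒟 ψ = 0`, is uniformly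
asymptotically stable. -/
def Stable (D : DifferenceOperator n p Δ) : Prop :=
  (∀ ε : ℝ, 0 < ε → ∃ δ : ℝ, 0 < δ ∧ ∀ y, D.IsHomogeneousSolution y →
      ‖histSegment y 0‖ < δ → ∀ t : ℝ, 0 ≤ t → ‖histSegment y t‖ < ε) ∧
  ∃ b : ℝ, 0 < b ∧ ∀ η : ℝ, 0 < η → ∃ T : ℝ, 0 ≤ T ∧ ∀ y, D.IsHomogeneousSolution y →
      ‖histSegment y 0‖ < b → ∀ t : ℝ, T ≤ t → ‖histSegment y t‖ < η

/-- `𝒟` is strongly stable (stable globally in the delays): the operator with the same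
matrices `A₁, …, A_p` is stable for every choice of positive delays. -/
def StronglyStable (D : DifferenceOperator n p Δ) : Prop :=
  ∀ (R : ℝ) (D' : DifferenceOperator n p R), D'.A = D.A → D'.Stable

/-- `x : [-Δ, ∞) → ℝⁿ` is a (global) solution of the neutral equation
`d/dt 𝒟 x_t = f(x_t)`, `t ≥ 0`, `x_0 = ξ` (the derivative at `t = 0` is one-sided). -/
def IsSolution (D : DifferenceOperator n p Δ) (f : Hist n Δ → Vec n) (ξ : Hist n Δ)
    (x : C(Ici (-Δ), Vec n)) : Prop :=
  histSegment x 0 = ξ ∧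
  ∀ t : ℝ, 0 ≤ t →
    HasDerivWithinAt (fun s : ℝ => D.map (histSegment x s)) (f (histSegment x t)) (Ici 0) t

/-- The neutral system is 0-GES: there are `M, lam > 0` such that for every initial condition `ξ`
the solution exists on `[0, ∞)` and satisfies `|x(t)| ≤ M e^{-lam t} ‖ξ‖` for `t ≥ 0`. -/
def IsZeroGES (D : DifferenceOperator n p Δ) (f : Hist n Δ → Vec n) : Prop :=
  ∃ M lam : ℝ, 0 < M ∧ 0 < lam ∧ ∀ ξ : Hist n Δ,
    (∃ x, D.IsSolution f ξ x) ∧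
    ∀ x, D.IsSolution f ξ x →
      ∀ t : Ici (-Δ), 0 ≤ (t : ℝ) → ‖x t‖ ≤ M * Real.exp (-lam * t) * ‖ξ‖

/-- `clampPt s` is the point of `[-Δ, 0]` nearest to `s`. -/
noncomputable def clampPt (D : DifferenceOperator n p Δ) (s : ℝ) : Icc (-Δ) (0 : ℝ) :=
  projIcc (-Δ) 0 (by linarith [D.maxDelay_pos]) s

theorem continuous_clampPt (D : DifferenceOperator n p Δ) : Continuous D.clampPt :=
  continuous_projIcc (h := by linarith [D.maxDelay_pos])

theorem clampPt_of_nonneg (D : DifferenceOperator n p Δ) {s : ℝ} (hs : 0 ≤ s) :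
    D.clampPt s = D.zeroPt :=
  projIcc_of_right_le _ hs

theorem clampPt_of_mem (D : DifferenceOperator n p Δ) {s : ℝ} (hs : s ∈ Icc (-Δ) (0 : ℝ)) :
    D.clampPt s = ⟨s, hs⟩ :=
  projIcc_of_mem _ hs

/-- For `θ ≥ 0`, the function `φ*_θ ∈ 𝒞` with `φ*_θ(s) = φ(s + θ)` for `s ∈ [-Δ, -θ]` and
`φ*_θ(s) = φ(0)` for `s ∈ (-θ, 0]` (see `star_apply_of_le` and `star_apply_of_lt`). -/
noncomputable def star (D : DifferenceOperator n p Δ) (φ : Hist n Δ) (θ : ℝ) : Hist n Δ where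
  toFun s := φ (D.clampPt (s + θ))
  continuous_toFun := by have := D.continuous_clampPt; fun_prop

theorem star_apply_of_le (D : DifferenceOperator n p Δ) (φ : Hist n Δ) {θ : ℝ} (hθ : 0 ≤ θ)
    (s : Icc (-Δ) (0 : ℝ)) (hs : (s : ℝ) ≤ -θ) :
    D.star φ θ s = φ ⟨s + θ, by have := s.2.1; linarith, by linarith⟩ :=
  congrArg φ (D.clampPt_of_mem _)

theorem star_apply_of_lt (D : DifferenceOperator n p Δ) (φ : Hist n Δ) {θ : ℝ}
    (s : Icc (-Δ) (0 : ℝ)) (hs : -θ < (s : ℝ)) : D.star φ θ s = φ D.zeroPt :=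
  congrArg φ (D.clampPt_of_nonneg (by linarith))

theorem star_zero (D : DifferenceOperator n p Δ) (φ : Hist n Δ) : D.star φ 0 = φ := by
  ext1 s
  refine congrArg φ ?_
  rw [add_zero]
  exact D.clampPt_of_mem s.2

theorem continuous_map_star (D : DifferenceOperator n p Δ) (φ : Hist n Δ) :
    Continuous fun θ : ℝ => D.map (D.star φ θ) := by
  have h := D.continuous_clampPt
  have h1 : ∀ s : Icc (-Δ) (0 : ℝ), Continuous fun θ : ℝ => D.star φ θ s := fun s => by
    change Continuous fun θ : ℝ => φ (D.clampPt (s + θ))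
    fun_prop
  unfold map
  refine (h1 _).sub (continuous_finsetSum _ fun j _ => ?_)
  exact (LinearMap.continuous_of_finiteDimensional _).comp (h1 _)

/-- For `0 < h < Δ`, the function `φ_h ∈ 𝒞` of Driver's form of the derivative:
`φ_h(s) = φ(s + h)` for `s ∈ [-Δ, -h]` and
`φ_h(s) = 𝒟 φ + (s + h) f(φ) - 𝒟 φ*_{s+h} + φ(0)` for `s ∈ (-h, 0]`.
(For `h ≥ 0` and `s ≤ -h` one has `clampPt (s + h) = s + h`.) -/
noncomputable def driverStep (D : DifferenceOperator n p Δ) (f : Hist n Δ → Vec n)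
    (φ : Hist n Δ) (h : ℝ) : Hist n Δ where
  toFun s :=
    if (s : ℝ) ≤ -h then φ (D.clampPt (s + h))
    else D.map φ + ((s : ℝ) + h) • f φ - D.map (D.star φ (s + h)) + φ D.zeroPt
  continuous_toFun := by
    have h1 := D.continuous_clampPt
    have h2 := D.continuous_map_star φ
    have h3 : Continuous fun s : Icc (-Δ) (0 : ℝ) => D.map (D.star φ (s + h)) :=
      h2.comp (by fun_prop)
    refine Continuous.if_le (by fun_prop) (by fun_prop) (by fun_prop) continuous_const ?_
    intro s hs
    have h0 : (s : ℝ) + h = 0 := by linarith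
    simp [h0, star_zero, D.clampPt_of_nonneg le_rfl]

/-- Driver's derivative `D⁺V(φ) = limsup_{h → 0⁺} (V(φ_h) - V(φ)) / h ∈ [-∞, ∞]` of `V` along
the neutral equation. -/
noncomputable def driverDeriv (D : DifferenceOperator n p Δ) (f : Hist n Δ → Vec n)
    (V : Hist n Δ → ℝ≥0) (φ : Hist n Δ) : EReal :=
  limsup (fun h : ℝ => ((((V (D.driverStep f φ h) : ℝ) - (V φ : ℝ)) / h : ℝ) : EReal)) (𝓝[>] 0)

end DifferenceOperator

/-! Sufficiency: Driver's perturbation `φ_h` agrees with the true solution segment `x_h` up to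
`o(h)` (`IsSolution.tendsto_driverStep`). Since `V` is Lipschitz, `D⁺V` therefore controls the
growth of `V` along solutions, and Gronwall gives `V(x_t) ≤ e^{-a₃ t} V(ξ)`. With (i) this makes `𝒟
x_t` decay exponentially. Stability of `𝒟`, for the delays at hand, passes the decay from `𝒟 x_t` to
`x_t` (`Stable.exists_decay`): homogeneous solutions halve over a fixed time, and the input only
adds a decaying error.

Necessity: with decay rate `λ`, set `V(φ) = sup_{t ≥ 0} e^{λt/2} ‖x_t(φ)‖`
(`IsZeroGES.exists_lyapunov`). The semigroup property gives `V(x_s) ≤ e^{-λs/2} V(φ)`. Late times do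
not matter for the supremum, because the solution decays faster than the weight grows. So `V` is
Lipschitz as soon as the flow is Lipschitz on bounded time intervals (`exists_flow_bound`).

Existence, uniqueness and the flow bound all come from one device: in the norm weighted by `e^{-Kt}`
with `K` large, both the delayed terms and the integral term are small. -/

namespace DifferenceOperator

variable {n p : ℕ} {Δ : ℝ}

/-! ### Bounds for the difference operator -/

theorem map_sub (D : DifferenceOperator n p Δ) (φ ψ : Hist n Δ) :
    D.map (φ - ψ) = D.map φ - D.map ψ := by
  simp only [map, ContinuousMap.sub_apply, _root_.map_sub, Finset.sum_sub_distrib]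
  abel

theorem map_smul (D : DifferenceOperator n p Δ) (c : ℝ) (φ : Hist n Δ) :
    D.map (c • φ) = c • D.map φ := by
  simp only [map, ContinuousMap.smul_apply, _root_.map_smul, ← Finset.smul_sum, smul_sub]

/-- The sum of the operator norms of the matrices `Aⱼ`. -/
noncomputable def delayGain (D : DifferenceOperator n p Δ) : ℝ :=
  ∑ j, ‖LinearMap.toContinuousLinearMap (Matrix.toEuclideanLin (D.A j))‖

theorem delayGain_nonneg (D : DifferenceOperator n p Δ) : 0 ≤ D.delayGain :=
  Finset.sum_nonneg fun _ _ => norm_nonneg _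

theorem norm_delaySum_le (D : DifferenceOperator n p Δ) (v : Fin p → Vec n) {c : ℝ}
    (hv : ∀ j, ‖v j‖ ≤ c) :
    ‖∑ j, Matrix.toEuclideanLin (D.A j) (v j)‖ ≤ D.delayGain * c := by
  rw [delayGain, Finset.sum_mul]
  refine (norm_sum_le _ _).trans (Finset.sum_le_sum fun j _ => ?_)
  refine ((LinearMap.toContinuousLinearMap (Matrix.toEuclideanLin (D.A j))).le_opNorm (v j)).trans ?_
  exact mul_le_mul_of_nonneg_left (hv j) (norm_nonneg _)

theorem norm_map_le (D : DifferenceOperator n p Δ) (φ : Hist n Δ) :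
    ‖D.map φ‖ ≤ (1 + D.delayGain) * ‖φ‖ := by
  have h1 := φ.norm_coe_le_norm D.zeroPt
  have h2 := D.norm_delaySum_le (fun j => φ (D.delayPt j)) fun j => φ.norm_coe_le_norm _
  have h3 := norm_sub_le (φ D.zeroPt) (∑ j, Matrix.toEuclideanLin (D.A j) (φ (D.delayPt j)))
  rw [map]
  linarith

theorem continuous_map (D : DifferenceOperator n p Δ) : Continuous D.map := by
  refine (LipschitzWith.of_dist_le_mul (K := ⟨1 + D.delayGain, by
    have := D.delayGain_nonneg; positivity⟩) fun φ ψ => ?_).continuous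
  rw [dist_eq_norm, dist_eq_norm, ← map_sub]
  exact D.norm_map_le _

theorem exists_le_delay (D : DifferenceOperator n p Δ) : ∃ r : ℝ, 0 < r ∧ ∀ j, r ≤ D.delay j := by
  rcases isEmpty_or_nonempty (Fin p) with h | h
  · exact ⟨1, one_pos, fun j => h.elim j⟩
  · obtain ⟨i, hi⟩ := Finite.exists_min D.delay
    exact ⟨D.delay i, D.delay_pos i, hi⟩

/-- Under the weight `e^{-Kt}`, a delay of at least `r` gains a factor `e^{-Kr}` and integration in
time gains `1/K`. For `K` large both effects are small, whatever the size of the matrices. -/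
theorem exists_rate (D : DifferenceOperator n p Δ) (L : ℝ) {r : ℝ} (hr : 0 < r) :
    ∃ K : ℝ, 0 < K ∧ D.delayGain * Real.exp (-(K * r)) ≤ 1 / 8 ∧ L ≤ K / 8 := by
  have h1 : Tendsto (fun K : ℝ => D.delayGain * Real.exp (-(K * r))) atTop (𝓝 (D.delayGain * 0)) :=
    (Real.tendsto_exp_neg_atTop_nhds_zero.comp (tendsto_id.atTop_mul_const hr)).const_mul _
  rw [mul_zero] at h1
  obtain ⟨K, hK, hK1, hK2⟩ := ((h1.eventually (eventually_le_nhds (by norm_num : (0 : ℝ) < 1 / 8))).and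
    ((eventually_gt_atTop 0).and (eventually_ge_atTop (8 * L)))).exists
  exact ⟨K, hK1, hK, by linarith⟩

end DifferenceOperator

/-! ### History segments of a trajectory -/

section Segments

variable {n : ℕ} {Δ : ℝ}

theorem histSegment_sub (x y : C(Ici (-Δ), Vec n)) (t : ℝ) :
    histSegment (x - y) t = histSegment x t - histSegment y t := rfl

theorem histSegment_smul (c : ℝ) (x : C(Ici (-Δ), Vec n)) (t : ℝ) :
    histSegment (c • x) t = c • histSegment x t := rfl

theorem continuous_histSegment (x : C(Ici (-Δ), Vec n)) : Continuous (histSegment x) := by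
  have h : Continuous fun q : ℝ × Icc (-Δ) (0 : ℝ) =>
      x ⟨max (-Δ) (q.1 + q.2), mem_Ici.2 (le_max_left _ _)⟩ :=
    x.continuous.comp (Continuous.subtype_mk (by fun_prop) _)
  exact (ContinuousMap.curry ⟨_, h⟩).continuous

theorem histSegment_norm_le {x : C(Ici (-Δ), Vec n)} {t c : ℝ} (ht : 0 ≤ t) (hc : 0 ≤ c)
    (h : ∀ u : Ici (-Δ), t - Δ ≤ u → (u : ℝ) ≤ t → ‖x u‖ ≤ c) : ‖histSegment x t‖ ≤ c := by
  refine (ContinuousMap.norm_le _ hc).2 fun τ => ?_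
  rw [histSegment_apply x ht]
  have h1 := τ.2.1
  have h2 := τ.2.2
  exact h _ (by simp only; linarith) (by simp only; linarith)

theorem norm_apply_le_norm_histSegment (x : C(Ici (-Δ), Vec n)) {t : ℝ} (ht : 0 ≤ t)
    (u : Ici (-Δ)) (h1 : t - Δ ≤ u) (h2 : (u : ℝ) ≤ t) : ‖x u‖ ≤ ‖histSegment x t‖ := by
  have h := (histSegment x t).norm_coe_le_norm ⟨u - t, by linarith, by linarith⟩
  rw [histSegment_apply x ht] at h
  simpa using h

theorem histSegment_zeroPt {p : ℕ} (D : DifferenceOperator n p Δ) (x : C(Ici (-Δ), Vec n)) {t : ℝ}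
    (ht : 0 ≤ t) :
    histSegment x t D.zeroPt = x ⟨t, by have := D.maxDelay_pos; simp only [mem_Ici]; linarith⟩ := by
  rw [histSegment_apply x ht]
  simp [DifferenceOperator.zeroPt]

theorem histSegment_delayPt {p : ℕ} (D : DifferenceOperator n p Δ) (x : C(Ici (-Δ), Vec n)) {t : ℝ}
    (ht : 0 ≤ t) (j : Fin p) :
    histSegment x t (D.delayPt j) =
      x ⟨t - D.delay j, by have := D.delay_le j; simp only [mem_Ici]; linarith⟩ := by
  rw [histSegment_apply x ht]
  simp [DifferenceOperator.delayPt, sub_eq_add_neg]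

end Segments

/-! ### Growth bounds, Lipschitz dependence and uniqueness -/

theorem integral_exp_mul_le {K : ℝ} (hK : 0 < K) (t : ℝ) :
    ∫ s in (0 : ℝ)..t, Real.exp (K * s) ≤ Real.exp (K * t) / K := by
  rw [intervalIntegral.integral_comp_mul_left (fun s => Real.exp s) hK.ne', integral_exp,
    smul_eq_mul, mul_zero, Real.exp_zero, div_eq_inv_mul]
  exact mul_le_mul_of_nonneg_left (by linarith) (by positivity)

namespace DifferenceOperator

variable {n p : ℕ} {Δ : ℝ}

/-- Take the maximum `N` of `e^{-Ks} ‖z_s‖` over `[0, T]`, attained at `t₀`. Recovering `z(u)` from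
`𝒟 z_u` and the delayed values, the terms involving `N` amount to at most `e^{K t₀} N / 2`, which is
absorbed at `t₀`. -/
theorem exists_growth_bound (D : DifferenceOperator n p Δ) {L : ℝ} (hL : 0 ≤ L) :
    ∃ K : ℝ, 0 < K ∧ ∀ (z : C(Ici (-Δ), Vec n)) (T c : ℝ), 0 ≤ c →
      (∀ t, 0 ≤ t → t ≤ T →
        ‖D.map (histSegment z t)‖ ≤ c + L * ∫ s in (0 : ℝ)..t, ‖histSegment z s‖) →
      ∀ t, 0 ≤ t → t ≤ T → ‖histSegment z t‖ ≤
        2 * Real.exp (K * t) * ((1 + D.delayGain) * ‖histSegment z 0‖ + c) := by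
  obtain ⟨r, hr, hrd⟩ := D.exists_le_delay
  obtain ⟨K, hK, hK1, hK2⟩ := D.exists_rate L hr
  refine ⟨K, hK, fun z T c hc hz t ht htT => ?_⟩
  have ha := D.delayGain_nonneg
  have hcont : Continuous fun s => Real.exp (-(K * s)) * ‖histSegment z s‖ := by
    have := continuous_histSegment z
    fun_prop
  obtain ⟨t₀, ⟨ht₀, ht₀T⟩, hmax⟩ := (isCompact_Icc (a := (0 : ℝ)) (b := T)).exists_isMaxOn
    ⟨t, ht, htT⟩ hcont.continuousOn
  set N := Real.exp (-(K * t₀)) * ‖histSegment z t₀‖ with hN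
  have hN0 : 0 ≤ N := by positivity
  have hzN : ∀ s, 0 ≤ s → s ≤ T → ‖histSegment z s‖ ≤ Real.exp (K * s) * N := fun s hs hsT => by
    have h := hmax (show s ∈ Icc 0 T from ⟨hs, hsT⟩)
    simp only [mem_ofPred_eq] at h
    rw [Real.exp_neg, inv_mul_le_iff₀ (Real.exp_pos _)] at h
    exact h
  have hpt : ∀ u : Ici (-Δ), (u : ℝ) ≤ t₀ →
      ‖z u‖ ≤ (1 + D.delayGain) * ‖histSegment z 0‖ + c + Real.exp (K * t₀) * N / 2 := by
    intro u hu
    rcases le_or_gt (u : ℝ) 0 with h0 | h0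
    · have h1 := norm_apply_le_norm_histSegment z le_rfl u
        (by have := u.2; simp only [mem_Ici] at this; linarith) h0
      have h2 : 0 ≤ Real.exp (K * t₀) * N := by positivity
      have h3 := mul_nonneg ha (norm_nonneg (histSegment z 0))
      linarith
    · have h1 := hz u h0.le (hu.trans ht₀T)
      have h2 : ∫ s in (0 : ℝ)..u, ‖histSegment z s‖ ≤ Real.exp (K * u) / K * N := by
        calc _ ≤ ∫ s in (0 : ℝ)..u, Real.exp (K * s) * N := by
              refine intervalIntegral.integral_mono_on h0.le
                ((continuous_histSegment z).norm.intervalIntegrable _ _)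
                (Continuous.intervalIntegrable (by fun_prop) _ _) fun s hs => ?_
              exact hzN s hs.1 (hs.2.trans (hu.trans ht₀T))
          _ ≤ _ := by
              rw [intervalIntegral.integral_mul_const]
              exact mul_le_mul_of_nonneg_right (integral_exp_mul_le hK _) hN0
      have h3 : L * ∫ s in (0 : ℝ)..u, ‖histSegment z s‖ ≤ Real.exp (K * u) * N / 8 := by
        calc _ ≤ L * (Real.exp (K * u) / K * N) := mul_le_mul_of_nonneg_left h2 hL
          _ ≤ K / 8 * (Real.exp (K * u) / K * N) := mul_le_mul_of_nonneg_right hK2 (by positivity)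
          _ = _ := by field_simp
      have h4 : ∀ j, ‖histSegment z u (D.delayPt j)‖ ≤
          ‖histSegment z 0‖ + Real.exp (K * u) * Real.exp (-(K * r)) * N := by
        intro j
        rw [histSegment_delayPt D z h0.le]
        have hj := D.delay_le j
        have hrj := hrd j
        -- A delayed time either falls in the initial history or is at least `r` before `u`, where
        -- the weighted bound gains `e^{-Kr}`.
        rcases le_or_gt ((u : ℝ) - D.delay j) 0 with h5 | h5
        · have h6 := norm_apply_le_norm_histSegment z le_rfl ⟨u - D.delay j, by
            simp only [mem_Ici]; linarith⟩ (by simp only; linarith) h5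
          have h7 : 0 ≤ Real.exp (K * u) * Real.exp (-(K * r)) * N := by positivity
          linarith
        · have h6 := norm_apply_le_norm_histSegment z h5.le ⟨u - D.delay j, by
            simp only [mem_Ici]; linarith⟩ (by simp only; linarith [D.maxDelay_pos]) le_rfl
          have h7 := hzN _ h5.le (by linarith)
          have h8 : Real.exp (K * (u - D.delay j)) ≤ Real.exp (K * u) * Real.exp (-(K * r)) := by
            rw [← Real.exp_add]
            refine Real.exp_le_exp.2 ?_
            nlinarith
          have h9 := mul_le_mul_of_nonneg_right h8 hN0
          have h10 := norm_nonneg (histSegment z 0)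
          linarith
      have h5 := D.norm_delaySum_le (fun j => histSegment z u (D.delayPt j)) h4
      have h6 : z u = D.map (histSegment z u) +
          ∑ j, Matrix.toEuclideanLin (D.A j) (histSegment z u (D.delayPt j)) := by
        rw [map, sub_add_cancel, histSegment_zeroPt D z h0.le]
      have h7 : D.delayGain * (Real.exp (K * u) * Real.exp (-(K * r)) * N) ≤
          Real.exp (K * u) * N / 8 := by
        have := mul_le_mul_of_nonneg_right hK1 (show 0 ≤ Real.exp (K * u) * N by positivity)
        linarith
      have h8 : Real.exp (K * u) * N ≤ Real.exp (K * t₀) * N := by gcongr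
      have h9 : 0 ≤ Real.exp (K * u) * N := by positivity
      have h10 := norm_nonneg (histSegment z 0)
      rw [h6]
      refine (norm_add_le _ _).trans ?_
      rw [mul_add] at h5
      linarith
  have hN2 : Real.exp (K * t₀) * N = ‖histSegment z t₀‖ := by
    rw [hN, ← mul_assoc, ← Real.exp_add, add_neg_cancel, Real.exp_zero, one_mul]
  have h1 := histSegment_norm_le ht₀ (by positivity) fun u _ hu => hpt u hu
  rw [hN2] at h1
  -- Here `h1` bounds `‖z_{t₀}‖` by data plus half of itself.
  have h2 : N ≤ 2 * ((1 + D.delayGain) * ‖histSegment z 0‖ + c) := by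
    have h3 : N ≤ ‖histSegment z t₀‖ := by
      rw [hN]
      refine mul_le_of_le_one_left (norm_nonneg _) (Real.exp_le_one_iff.2 ?_)
      have := mul_nonneg hK.le ht₀
      linarith
    linarith
  calc _ ≤ Real.exp (K * t) * N := hzN t ht htT
    _ ≤ Real.exp (K * t) * (2 * ((1 + D.delayGain) * ‖histSegment z 0‖ + c)) := by gcongr
    _ = _ := by ring

theorem IsSolution.map_sub_eq_integral {D : DifferenceOperator n p Δ} {f : Hist n Δ → Vec n}
    (hf : Continuous f) {ξ : Hist n Δ} {x : C(Ici (-Δ), Vec n)} (hx : D.IsSolution f ξ x) {t : ℝ}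
    (ht : 0 ≤ t) :
    D.map (histSegment x t) - D.map ξ = ∫ s in (0 : ℝ)..t, f (histSegment x s) := by
  have hc := continuous_histSegment x
  rw [intervalIntegral.integral_eq_sub_of_hasDeriv_right_of_le ht
    (f := fun s => D.map (histSegment x s)) (D.continuous_map.comp hc).continuousOn
    (fun s hs => (hx.2 s hs.1.le).mono fun u hu => hs.1.le.trans (le_of_lt hu))
    ((hf.comp hc).intervalIntegrable _ _), hx.1]

/-- Lipschitz dependence of solutions on their initial segments, on bounded time intervals. -/
theorem exists_flow_bound (D : DifferenceOperator n p Δ) {f : Hist n Δ → Vec n} {L : ℝ≥0}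
    (hf : LipschitzWith L f) :
    ∃ G K : ℝ, 0 < G ∧ 0 < K ∧ ∀ (ξ η : Hist n Δ) (x y : C(Ici (-Δ), Vec n)),
      D.IsSolution f ξ x → D.IsSolution f η y → ∀ t, 0 ≤ t →
        ‖histSegment x t - histSegment y t‖ ≤ G * Real.exp (K * t) * ‖ξ - η‖ := by
  obtain ⟨K, hK, h⟩ := D.exists_growth_bound L.coe_nonneg
  have ha := D.delayGain_nonneg
  refine ⟨2 * ((1 + D.delayGain) + (1 + D.delayGain)), K, by positivity, hK,
    fun ξ η x y hx hy t ht => ?_⟩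
  have h0 : histSegment (x - y) 0 = ξ - η := by rw [histSegment_sub, hx.1, hy.1]
  have h1 := h (x - y) t ((1 + D.delayGain) * ‖ξ - η‖) (by positivity) ?_ t ht le_rfl
  · rw [h0] at h1
    rw [← histSegment_sub]
    linarith
  · intro s hs hst
    have hcx : Continuous fun s => f (histSegment x s) :=
      hf.continuous.comp (continuous_histSegment x)
    have hcy : Continuous fun s => f (histSegment y s) :=
      hf.continuous.comp (continuous_histSegment y)
    have h2 : D.map (histSegment (x - y) s) = D.map (ξ - η) +
        ∫ u in (0 : ℝ)..s, (f (histSegment x u) - f (histSegment y u)) := by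
      rw [intervalIntegral.integral_sub (hcx.intervalIntegrable _ _) (hcy.intervalIntegrable _ _),
        ← hx.map_sub_eq_integral hf.continuous hs, ← hy.map_sub_eq_integral hf.continuous hs,
        histSegment_sub, map_sub, map_sub]
      abel
    have h3 : ‖∫ u in (0 : ℝ)..s, (f (histSegment x u) - f (histSegment y u))‖ ≤
        L * ∫ u in (0 : ℝ)..s, ‖histSegment (x - y) u‖ := by
      refine (intervalIntegral.norm_integral_le_integral_norm hs).trans ?_
      rw [← intervalIntegral.integral_const_mul]
      refine intervalIntegral.integral_mono_on hs ((hcx.sub hcy).norm.intervalIntegrable _ _)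
        (((continuous_histSegment (x - y)).norm.const_mul _).intervalIntegrable _ _) fun u _ => ?_
      rw [histSegment_sub]
      exact hf.norm_sub_le _ _
    rw [h2]
    exact (norm_add_le _ _).trans (add_le_add (D.norm_map_le _) h3)

theorem IsSolution.histSegment_eq {D : DifferenceOperator n p Δ} {f : Hist n Δ → Vec n} {L : ℝ≥0}
    (hf : LipschitzWith L f) {ξ : Hist n Δ} {x y : C(Ici (-Δ), Vec n)} (hx : D.IsSolution f ξ x)
    (hy : D.IsSolution f ξ y) {t : ℝ} (ht : 0 ≤ t) : histSegment x t = histSegment y t := by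
  obtain ⟨G, K, -, -, h⟩ := D.exists_flow_bound hf
  have h1 := h ξ ξ x y hx hy t ht
  rw [sub_self, norm_zero, mul_zero] at h1
  exact sub_eq_zero.1 (norm_le_zero_iff.1 h1)

/-! ### Global existence by a weighted contraction -/

open scoped BoundedContinuousFunction

/-- The function on `[-Δ, ∞)` that extends `ξ` and equals `ξ(0) + e^{K t} (u(t) - u(0))` for
`t ≥ 0`. -/
noncomputable def extension (D : DifferenceOperator n p Δ) (ξ : Hist n Δ) (K : ℝ)
    (u : ℝ →ᵇ Vec n) : C(Ici (-Δ), Vec n) where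
  toFun t := ξ (D.clampPt t) + Real.exp (K * max (t : ℝ) 0) • (u (max (t : ℝ) 0) - u 0)
  continuous_toFun := by
    have := D.continuous_clampPt
    have := u.continuous
    fun_prop

theorem extension_apply (D : DifferenceOperator n p Δ) (ξ : Hist n Δ) (K : ℝ) (u : ℝ →ᵇ Vec n)
    (t : Ici (-Δ)) : D.extension ξ K u t =
      ξ (D.clampPt t) + Real.exp (K * max (t : ℝ) 0) • (u (max (t : ℝ) 0) - u 0) := rfl

theorem histSegment_extension_zero (D : DifferenceOperator n p Δ) (ξ : Hist n Δ) (K : ℝ)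
    (u : ℝ →ᵇ Vec n) : histSegment (D.extension ξ K u) 0 = ξ := by
  ext1 τ
  have h := τ.2.2
  rw [histSegment_apply _ le_rfl, extension_apply]
  simp only [zero_add]
  rw [max_eq_right h, sub_self, smul_zero, add_zero, D.clampPt_of_mem τ.2]

theorem norm_extension_sub_le (D : DifferenceOperator n p Δ) (ξ : Hist n Δ) (K : ℝ)
    (u v : ℝ →ᵇ Vec n) (t : Ici (-Δ)) :
    ‖D.extension ξ K u t - D.extension ξ K v t‖ ≤
      2 * Real.exp (K * max (t : ℝ) 0) * ‖u - v‖ := by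
  have h : D.extension ξ K u t - D.extension ξ K v t =
      Real.exp (K * max (t : ℝ) 0) • ((u - v) (max (t : ℝ) 0) - (u - v) 0) := by
    rw [extension_apply, extension_apply, add_sub_add_left_eq_sub, ← smul_sub]
    simp only [BoundedContinuousFunction.sub_apply]
    congr 1
    abel
  rw [h, norm_smul, Real.norm_of_nonneg (Real.exp_pos _).le]
  have h1 := norm_sub_le ((u - v) (max (t : ℝ) 0)) ((u - v) 0)
  have h2 := (u - v).norm_coe_le_norm (max (t : ℝ) 0)
  have h3 := (u - v).norm_coe_le_norm 0
  rw [mul_comm 2, mul_assoc]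
  exact mul_le_mul_of_nonneg_left (by linarith) (Real.exp_pos _).le

theorem extension_zero_norm_le (D : DifferenceOperator n p Δ) (ξ : Hist n Δ) (K : ℝ)
    (t : Ici (-Δ)) : ‖D.extension ξ K 0 t‖ ≤ ‖ξ‖ := by
  rw [extension_apply]
  simpa using ξ.norm_coe_le_norm _

theorem norm_histSegment_extension_sub_le (D : DifferenceOperator n p Δ) (ξ : Hist n Δ) {K : ℝ}
    (hK : 0 < K) (u v : ℝ →ᵇ Vec n) {t : ℝ} (ht : 0 ≤ t) :
    ‖histSegment (D.extension ξ K u) t - histSegment (D.extension ξ K v) t‖ ≤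
      2 * Real.exp (K * t) * ‖u - v‖ := by
  rw [← histSegment_sub]
  refine histSegment_norm_le ht (by positivity) fun s _ hs => ?_
  refine (D.norm_extension_sub_le ξ K u v s).trans ?_
  have : max (s : ℝ) 0 ≤ t := max_le hs ht
  gcongr

/-- The right-hand side of the integrated neutral equation at time `t`, minus `ξ(0)`. -/
noncomputable def picard (D : DifferenceOperator n p Δ) (f : Hist n Δ → Vec n) (ξ : Hist n Δ)
    (K : ℝ) (u : ℝ →ᵇ Vec n) (t : ℝ) : Vec n :=
  (∑ j, Matrix.toEuclideanLin (D.A j) (histSegment (D.extension ξ K u) t (D.delayPt j))) +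
    D.map ξ + (∫ s in (0 : ℝ)..t, f (histSegment (D.extension ξ K u) s)) - ξ D.zeroPt

theorem continuous_picard (D : DifferenceOperator n p Δ) {f : Hist n Δ → Vec n}
    (hf : Continuous f) (ξ : Hist n Δ) (K : ℝ) (u : ℝ →ᵇ Vec n) :
    Continuous (D.picard f ξ K u) := by
  have hc := continuous_histSegment (D.extension ξ K u)
  have h1 := intervalIntegral.continuous_primitive (μ := MeasureTheory.volume)
    (fun a b => (hf.comp hc).intervalIntegrable a b) 0
  refine ((((continuous_finsetSum _ fun j _ => ?_).add continuous_const).add h1).sub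
    continuous_const)
  exact (LinearMap.continuous_of_finiteDimensional _).comp ((continuous_eval_const _).comp hc)

/-- The increment `u(t) - u(0)` in `extension` costs a factor 2. Against the two bounds of order
`1/8` supplied by `K`, the delayed terms and the integral contribute `1/4` each. -/
theorem picard_sub_le (D : DifferenceOperator n p Δ) {f : Hist n Δ → Vec n} {L : ℝ≥0}
    (hf : LipschitzWith L f) (ξ : Hist n Δ) {K r : ℝ} (hrd : ∀ j, r ≤ D.delay j)
    (hK : 0 < K) (hK1 : D.delayGain * Real.exp (-(K * r)) ≤ 1 / 8) (hK2 : L ≤ K / 8)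
    (u v : ℝ →ᵇ Vec n) {t : ℝ} (ht : 0 ≤ t) :
    ‖D.picard f ξ K u t - D.picard f ξ K v t‖ ≤ Real.exp (K * t) * (1 / 2 * ‖u - v‖) := by
  set x := D.extension ξ K u with hx
  set y := D.extension ξ K v with hy
  have hcx : Continuous fun s => f (histSegment x s) :=
    hf.continuous.comp (continuous_histSegment x)
  have hcy : Continuous fun s => f (histSegment y s) :=
    hf.continuous.comp (continuous_histSegment y)
  have h1 : D.picard f ξ K u t - D.picard f ξ K v t =
      (∑ j, Matrix.toEuclideanLin (D.A j)
        (histSegment x t (D.delayPt j) - histSegment y t (D.delayPt j))) +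
      ∫ s in (0 : ℝ)..t, (f (histSegment x s) - f (histSegment y s)) := by
    rw [intervalIntegral.integral_sub (hcx.intervalIntegrable _ _) (hcy.intervalIntegrable _ _)]
    simp only [picard, _root_.map_sub, Finset.sum_sub_distrib, ← hx, ← hy]
    abel
  have h2 : ‖∫ s in (0 : ℝ)..t, (f (histSegment x s) - f (histSegment y s))‖ ≤
      Real.exp (K * t) * (1 / 4 * ‖u - v‖) := by
    refine (intervalIntegral.norm_integral_le_integral_norm ht).trans ?_
    calc _ ≤ ∫ s in (0 : ℝ)..t, Real.exp (K * s) * (2 * L * ‖u - v‖) := by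
          refine intervalIntegral.integral_mono_on ht ((hcx.sub hcy).norm.intervalIntegrable _ _)
            (Continuous.intervalIntegrable (by fun_prop) _ _) fun s hs => ?_
          have h3 := mul_le_mul_of_nonneg_left
            (D.norm_histSegment_extension_sub_le ξ hK u v hs.1) L.coe_nonneg
          have h4 := hf.norm_sub_le (histSegment x s) (histSegment y s)
          linarith
      _ ≤ Real.exp (K * t) / K * (2 * L * ‖u - v‖) := by
          rw [intervalIntegral.integral_mul_const]
          exact mul_le_mul_of_nonneg_right (integral_exp_mul_le hK _) (by positivity)
      _ ≤ Real.exp (K * t) / K * (2 * (K / 8) * ‖u - v‖) := by gcongr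
      _ = _ := by field_simp; ring
  have h3 : ∀ j, ‖histSegment x t (D.delayPt j) - histSegment y t (D.delayPt j)‖ ≤
      2 * (Real.exp (K * t) * Real.exp (-(K * r))) * ‖u - v‖ := by
    intro j
    have hj := D.delay_le j
    have hrj := hrd j
    rcases le_or_gt (t - D.delay j) 0 with h5 | h5
    · rw [histSegment_delayPt D _ ht, histSegment_delayPt D _ ht, hx, hy, extension_apply,
        extension_apply]
      simp only [max_eq_right h5, sub_self]
      simp only [norm_zero]
      positivity
    · rw [histSegment_delayPt D _ ht, histSegment_delayPt D _ ht]
      refine (D.norm_extension_sub_le ξ K u v _).trans ?_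
      simp only [max_eq_left h5.le, ← Real.exp_add]
      have : K * (t - D.delay j) ≤ K * t + -(K * r) := by nlinarith
      gcongr
  have h4 := D.norm_delaySum_le _ h3
  have h5 : D.delayGain * (2 * (Real.exp (K * t) * Real.exp (-(K * r))) * ‖u - v‖) ≤
      Real.exp (K * t) * (1 / 4 * ‖u - v‖) := by
    have := mul_le_mul_of_nonneg_right hK1 (show 0 ≤ 2 * Real.exp (K * t) * ‖u - v‖ by positivity)
    linarith
  rw [h1]
  refine (norm_add_le _ _).trans ?_
  linarith

theorem picard_zero_le (D : DifferenceOperator n p Δ) {f : Hist n Δ → Vec n} {L : ℝ≥0}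
    (hf : LipschitzWith L f) (hf0 : f 0 = 0) (ξ : Hist n Δ) {K : ℝ} (hK : 0 < K) (hK2 : L ≤ K / 8)
    {t : ℝ} (ht : 0 ≤ t) :
    ‖D.picard f ξ K 0 t‖ ≤ Real.exp (K * t) * ((3 + 2 * D.delayGain) * ‖ξ‖) := by
  set x := D.extension ξ K 0 with hx
  have hcx : Continuous fun s => f (histSegment x s) :=
    hf.continuous.comp (continuous_histSegment x)
  have hs : ∀ s, 0 ≤ s → ‖histSegment x s‖ ≤ ‖ξ‖ := fun s hs =>
    histSegment_norm_le hs (norm_nonneg _) fun u _ _ => D.extension_zero_norm_le ξ K u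
  have h1 := D.norm_delaySum_le (fun j => histSegment x t (D.delayPt j)) fun j =>
    ((histSegment x t).norm_coe_le_norm _).trans (hs t ht)
  have h2 := D.norm_map_le ξ
  have h3 := ξ.norm_coe_le_norm D.zeroPt
  have h4 : ‖∫ s in (0 : ℝ)..t, f (histSegment x s)‖ ≤ Real.exp (K * t) * ‖ξ‖ := by
    have h5 : ∀ s ∈ Set.uIoc 0 t, ‖f (histSegment x s)‖ ≤ L * ‖ξ‖ := fun s hst => by
      rw [uIoc_of_le ht] at hst
      have h6 := hf.norm_sub_le (histSegment x s) 0
      rw [hf0, sub_zero, sub_zero] at h6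
      exact h6.trans (mul_le_mul_of_nonneg_left (hs s hst.1.le) L.coe_nonneg)
    have h6 := intervalIntegral.norm_integral_le_of_norm_le_const h5
    rw [sub_zero, abs_of_nonneg ht] at h6
    have h7 : (L : ℝ) * t ≤ Real.exp (K * t) := by
      have := Real.add_one_le_exp (K * t)
      have := mul_le_mul_of_nonneg_right hK2 ht
      have := mul_nonneg hK.le ht
      linarith
    have := mul_le_mul_of_nonneg_right h7 (norm_nonneg ξ)
    linarith
  have h5 : 1 ≤ Real.exp (K * t) := Real.one_le_exp (by positivity)
  have h6 := norm_add₃_le (a := ∑ j, Matrix.toEuclideanLin (D.A j) (histSegment x t (D.delayPt j)))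
    (b := D.map ξ) (c := ∫ s in (0 : ℝ)..t, f (histSegment x s))
  have h7 := mul_le_mul_of_nonneg_right h5
    (show 0 ≤ (2 + 2 * D.delayGain) * ‖ξ‖ by have := D.delayGain_nonneg; positivity)
  rw [picard]
  refine (norm_sub_le _ _).trans ?_
  linarith

theorem exists_integral_solution (D : DifferenceOperator n p Δ) {f : Hist n Δ → Vec n} {L : ℝ≥0}
    (hf : LipschitzWith L f) (hf0 : f 0 = 0) (ξ : Hist n Δ) :
    ∃ x : C(Ici (-Δ), Vec n), histSegment x 0 = ξ ∧ ∀ t, 0 ≤ t →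
      D.map (histSegment x t) = D.map ξ + ∫ s in (0 : ℝ)..t, f (histSegment x s) := by
  obtain ⟨r, hr, hrd⟩ := D.exists_le_delay
  obtain ⟨K, hK, hK1, hK2⟩ := D.exists_rate L hr
  have hsub := fun u v t ht => D.picard_sub_le hf ξ hrd hK hK1 hK2 u v (t := t) ht
  -- The factor `e^{-Kt}` undoes the weight in `extension`, so the fixed-point problem lives in the
  -- plain sup norm. Freezing negative times at `0` gives functions on all of `ℝ`.
  let Φ : (ℝ →ᵇ Vec n) → (ℝ →ᵇ Vec n) := fun u => BoundedContinuousFunction.ofNormedAddCommGroup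
    (fun t => Real.exp (-(K * max t 0)) • D.picard f ξ K u (max t 0))
    (by have := D.continuous_picard hf.continuous ξ K u; fun_prop)
    (1 / 2 * ‖u - 0‖ + (3 + 2 * D.delayGain) * ‖ξ‖) fun t => by
      have h1 := hsub u 0 (max t 0) (le_max_right _ _)
      have h2 := D.picard_zero_le hf hf0 ξ hK hK2 (le_max_right t 0)
      have h3 := norm_le_norm_sub_add (D.picard f ξ K u (max t 0)) (D.picard f ξ K 0 (max t 0))
      rw [norm_smul, Real.norm_of_nonneg (Real.exp_pos _).le, Real.exp_neg,
        inv_mul_le_iff₀ (Real.exp_pos _)]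
      linarith
  have hΦ : ContractingWith (1 / 2) Φ := by
    refine ⟨by norm_num, LipschitzWith.of_dist_le_mul fun u v => ?_⟩
    rw [dist_eq_norm, dist_eq_norm]
    refine (BoundedContinuousFunction.norm_le (by positivity)).2 fun t => ?_
    change ‖Real.exp (-(K * max t 0)) • D.picard f ξ K u (max t 0) -
      Real.exp (-(K * max t 0)) • D.picard f ξ K v (max t 0)‖ ≤ _
    rw [← smul_sub, norm_smul, Real.norm_of_nonneg (Real.exp_pos _).le, Real.exp_neg,
        inv_mul_le_iff₀ (Real.exp_pos _)]
    simpa using hsub u v (max t 0) (le_max_right _ _)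
  obtain ⟨u, hu⟩ : ∃ u, Φ u = u := ⟨_, hΦ.fixedPoint_isFixedPt⟩
  have hut : ∀ t, 0 ≤ t → u t = Real.exp (-(K * t)) • D.picard f ξ K u t := fun t ht => by
    conv_lhs => rw [← hu]
    change Real.exp (-(K * max t 0)) • D.picard f ξ K u (max t 0) = _
    rw [max_eq_left ht]
  -- A fixed point vanishes at `0`, so the correction `u(t) - u(0)` built into `extension` is `u(t)`
  -- itself.
  have hu0 : u 0 = 0 := by
    rw [hut 0 le_rfl, picard, histSegment_extension_zero, intervalIntegral.integral_same, map]
    simp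
  refine ⟨D.extension ξ K u, D.histSegment_extension_zero ξ K u, fun t ht => ?_⟩
  have h1 : histSegment (D.extension ξ K u) t D.zeroPt = ξ D.zeroPt + D.picard f ξ K u t := by
    rw [histSegment_zeroPt D _ ht, extension_apply]
    simp only [max_eq_left ht, D.clampPt_of_nonneg ht, hu0, sub_zero]
    rw [hut t ht, smul_smul, ← Real.exp_add, add_neg_cancel, Real.exp_zero, one_smul]
  rw [map, h1, picard]
  abel

theorem exists_isSolution (D : DifferenceOperator n p Δ) {f : Hist n Δ → Vec n} {L : ℝ≥0}
    (hf : LipschitzWith L f) (hf0 : f 0 = 0) (ξ : Hist n Δ) : ∃ x, D.IsSolution f ξ x := by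
  obtain ⟨x, hx0, hx⟩ := D.exists_integral_solution hf hf0 ξ
  refine ⟨x, hx0, fun t ht => ?_⟩
  have hc := hf.continuous.comp (continuous_histSegment x)
  have h := (hc.integral_hasStrictDerivAt 0 t).hasDerivAt.hasDerivWithinAt (s := Ici 0)
  exact (h.const_add (D.map ξ)).congr (fun s hs => hx s hs) (hx t ht)

theorem exists_isHomogeneousSolution (D : DifferenceOperator n p Δ) {ψ : Hist n Δ}
    (hψ : D.map ψ = 0) : ∃ y, histSegment y 0 = ψ ∧ D.IsHomogeneousSolution y := by
  obtain ⟨y, hy0, hy⟩ := D.exists_integral_solution (f := fun _ => 0) (L := 0)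
    (LipschitzWith.const 0) rfl ψ
  exact ⟨y, hy0, fun t ht => by rw [hy t ht, hψ]; simp⟩

end DifferenceOperator

/-! ### Time translation of solutions -/

/-- The time shift `s ↦ x(t + s)`, for `t ≥ 0`. -/
noncomputable def timeShift {n : ℕ} {Δ : ℝ} (x : C(Ici (-Δ), Vec n)) (t : ℝ) :
    C(Ici (-Δ), Vec n) where
  toFun s := x ⟨max (-Δ) (t + s), mem_Ici.2 (le_max_left _ _)⟩
  continuous_toFun := x.continuous.comp (Continuous.subtype_mk (by fun_prop) _)

theorem histSegment_timeShift {n : ℕ} {Δ : ℝ} (x : C(Ici (-Δ), Vec n)) {t s : ℝ} (ht : 0 ≤ t)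
    (hs : 0 ≤ s) : histSegment (timeShift x t) s = histSegment x (t + s) := by
  ext1 τ
  have h : -Δ ≤ t + (s + τ) := by have := τ.2.1; linarith
  rw [histSegment_apply _ hs, histSegment_apply _ (add_nonneg ht hs)]
  simp only [timeShift, ContinuousMap.coe_mk, max_eq_right h, add_assoc]

theorem LipschitzWith.abs_coe_sub_le {E : Type*} [SeminormedAddCommGroup E] {V : E → ℝ≥0}
    {L : ℝ≥0} (hV : LipschitzWith L V) (φ ψ : E) : |(V φ : ℝ) - V ψ| ≤ L * ‖φ - ψ‖ := by
  have h := hV.dist_le_mul φ ψ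
  rwa [NNReal.dist_eq, dist_eq_norm] at h

namespace DifferenceOperator

variable {n p : ℕ} {Δ : ℝ}

theorem IsSolution.isSolution_timeShift {D : DifferenceOperator n p Δ} {f : Hist n Δ → Vec n} {ξ : Hist n Δ}
    {x : C(Ici (-Δ), Vec n)} (hx : D.IsSolution f ξ x) {t : ℝ} (ht : 0 ≤ t) :
    D.IsSolution f (histSegment x t) (timeShift x t) := by
  refine ⟨by rw [histSegment_timeShift x ht le_rfl, add_zero], fun s hs => ?_⟩
  rw [histSegment_timeShift x ht hs]
  have h1 := hx.2 (t + s) (add_nonneg ht hs)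
  have h2 : HasDerivWithinAt (fun u : ℝ => t + u) 1 (Ici 0) s :=
    ((hasDerivAt_id s).const_add t).hasDerivWithinAt
  have h3 := h1.scomp s h2 fun u hu => add_nonneg ht hu
  rw [one_smul] at h3
  exact h3.congr (fun u hu => by rw [histSegment_timeShift x ht hu]; rfl)
    (by rw [histSegment_timeShift x ht hs]; rfl)

/-! ### Driver's derivative along solutions -/

/-- Up to `o(h)`, Driver's perturbation `φ_h` is the solution segment `x_h`. -/
theorem IsSolution.tendsto_driverStep {D : DifferenceOperator n p Δ} {f : Hist n Δ → Vec n}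
    {φ : Hist n Δ} {x : C(Ici (-Δ), Vec n)} (hx : D.IsSolution f φ x) :
    Tendsto (fun h : ℝ => ‖D.driverStep f φ h - histSegment x h‖ / h) (𝓝[>] 0) (𝓝 0) := by
  obtain ⟨r, hr, hrd⟩ := D.exists_le_delay
  have hφ : ∀ s, -Δ ≤ s → s ≤ 0 → ∀ t : Ici (-Δ), (t : ℝ) = s → φ (D.clampPt s) = x t := by
    rintro s hs hs0 ⟨t, ht⟩ rfl
    rw [D.clampPt_of_mem ⟨hs, hs0⟩, ← hx.1, histSegment_apply _ le_rfl]
    simp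
  rw [Metric.tendsto_nhds]
  intro ε hε
  have h1 := (hasDerivWithinAt_iff_isLittleO.1 (hx.2 0 le_rfl)).def (half_pos hε)
  rw [eventually_nhdsWithin_iff, Metric.eventually_nhds_iff] at h1
  obtain ⟨δ, hδ, h1⟩ := h1
  have h2 : Ioo 0 (min δ r) ∈ 𝓝[>] (0 : ℝ) := Ioo_mem_nhdsGT (lt_min hδ hr)
  filter_upwards [h2] with h hh
  have hh0 := hh.1
  have hhδ := hh.2.trans_le (min_le_left _ _)
  have hhr := hh.2.trans_le (min_le_right _ _)
  have h3 : ‖D.driverStep f φ h - histSegment x h‖ ≤ ε / 2 * h := by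
    refine (ContinuousMap.norm_le _ (by positivity)).2 fun s => ?_
    have hs1 := s.2.1
    have hs2 := s.2.2
    rw [ContinuousMap.sub_apply, histSegment_apply x hh0.le]
    simp only [driverStep, ContinuousMap.coe_mk]
    split_ifs with hs
    · rw [hφ (s + h) (by linarith) (by linarith)
          ⟨h + s, by simp only [mem_Ici]; linarith⟩ (add_comm _ _), sub_self, norm_zero]
      positivity
    · have hθ : 0 < s + h := by linarith
      -- As `h < r`, the delayed values of `φ*_{s+h}` and `x_{s+h}` both still read the initial
      -- history and coincide. The two segments differ under `𝒟` only through their values at `0`,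
      -- so `φ_h(s) - x(s+h)` is the first-order remainder of `𝒟 x_t` at `t = 0`.
      have h4 : D.map (D.star φ (s + h)) =
          φ D.zeroPt - x ⟨h + s, by simp only [mem_Ici]; linarith⟩ +
            D.map (histSegment x (s + h)) := by
        rw [map, map, D.star_apply_of_lt _ _ (by simp only [zeroPt]; linarith),
          histSegment_zeroPt D x hθ.le]
        simp only [add_comm h (s : ℝ)]
        have h5 : ∀ j, D.star φ (s + h) (D.delayPt j) = histSegment x (s + h) (D.delayPt j) := by
          intro j
          have hj := D.delay_le j
          have hrj := hrd j
          rw [histSegment_delayPt D x hθ.le]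
          exact hφ _ (by simp only [delayPt]; linarith) (by simp only [delayPt]; linarith) _
            (by simp only [delayPt]; ring)
        simp only [h5]
        abel
      have h5 := h1 (y := s + h) (by
        rw [Real.dist_eq, sub_zero, abs_of_pos hθ]; linarith) hθ.le
      rw [hx.1, sub_zero, Real.norm_of_nonneg hθ.le] at h5
      have h6 : D.map φ + ((s : ℝ) + h) • f φ - D.map (D.star φ (s + h)) + φ D.zeroPt -
          x ⟨h + s, by simp only [mem_Ici]; linarith⟩ =
          -(D.map (histSegment x (s + h)) - D.map φ - ((s : ℝ) + h) • f φ) := by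
        rw [h4]
        abel
      rw [h6, norm_neg]
      exact h5.trans (mul_le_mul_of_nonneg_left (by linarith) (by positivity))
  rw [Real.dist_eq, sub_zero, abs_of_nonneg (by positivity), div_lt_iff₀ hh0]
  nlinarith

/-- The difference quotient is at most `(e^{-μh} - 1)/h · V(φ) + L ‖φ_h - x_h‖/h`, whose limit is
`-μ V(φ)`. -/
theorem IsSolution.driverDeriv_le {D : DifferenceOperator n p Δ} {f : Hist n Δ → Vec n}
    {φ : Hist n Δ} {x : C(Ici (-Δ), Vec n)} (hx : D.IsSolution f φ x) {V : Hist n Δ → ℝ≥0}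
    {L : ℝ≥0} (hV : LipschitzWith L V) {μ : ℝ}
    (hdecay : ∀ h, 0 ≤ h → (V (histSegment x h) : ℝ) ≤ Real.exp (-(μ * h)) * V φ) :
    D.driverDeriv f V φ ≤ ((-μ * (V φ : ℝ) : ℝ) : EReal) := by
  have h1 : HasDerivAt (fun h : ℝ => Real.exp (-(μ * h))) (-μ) 0 := by
    have h := ((hasDerivAt_id (0 : ℝ)).const_mul μ).neg.exp
    simpa using h
  have h2 : Tendsto (fun h : ℝ => h⁻¹ * (Real.exp (-(μ * h)) - 1)) (𝓝[>] 0) (𝓝 (-μ)) := by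
    have h := (hasDerivAt_iff_tendsto_slope.1 h1).mono_left
      (nhdsWithin_mono 0 fun u (hu : (0 : ℝ) < u) => hu.ne')
    refine h.congr fun u => ?_
    simp [slope_def_field, div_eq_inv_mul]
  have h3 := (h2.mul_const (V φ : ℝ)).add (hx.tendsto_driverStep.const_mul (L : ℝ))
  rw [mul_zero, add_zero] at h3
  have h4 := (continuous_coe_real_ereal.tendsto _).comp h3
  rw [← h4.limsup_eq]
  refine limsup_le_limsup ?_
  filter_upwards [self_mem_nhdsWithin] with h hh
  have hh : 0 < h := hh
  refine EReal.coe_le_coe_iff.2 ?_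
  have h5 := (abs_le.1 (hV.abs_coe_sub_le (D.driverStep f φ h) (histSegment x h))).2
  have h6 := hdecay h hh.le
  rw [div_le_iff₀ hh]
  have h7 : (h⁻¹ * (Real.exp (-(μ * h)) - 1) * (V φ : ℝ) +
      L * (‖D.driverStep f φ h - histSegment x h‖ / h)) * h =
      (Real.exp (-(μ * h)) - 1) * (V φ : ℝ) + L * ‖D.driverStep f φ h - histSegment x h‖ := by
    field_simp
  rw [h7]
  linarith

/-- Restarting the autonomous equation from `x_s` turns the bound at the single point `φ = x_s` into
a right Dini derivative bound for `s ↦ V(x_s)`, to which Gronwall applies. -/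
theorem IsSolution.decay_of_driverDeriv_le {D : DifferenceOperator n p Δ} {f : Hist n Δ → Vec n}
    {V : Hist n Δ → ℝ≥0} {L : ℝ≥0} (hV : LipschitzWith L V) {a : ℝ}
    (hd : ∀ φ, D.driverDeriv f V φ ≤ ((-a * (V φ : ℝ) : ℝ) : EReal))
    {ξ : Hist n Δ} {x : C(Ici (-Δ), Vec n)} (hx : D.IsSolution f ξ x) {t : ℝ} (ht : 0 ≤ t) :
    (V (histSegment x t) : ℝ) ≤ Real.exp (-a * t) * V ξ := by
  have hcont : Continuous fun s => (V (histSegment x s) : ℝ) :=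
    NNReal.continuous_coe.comp (hV.continuous.comp (continuous_histSegment x))
  have h := le_gronwallBound_of_liminf_deriv_right_le (f := fun s => (V (histSegment x s) : ℝ))
    (f' := fun s => -a * (V (histSegment x s) : ℝ)) (δ := V ξ) (K := -a) (ε := 0) (a := 0) (b := t)
    hcont.continuousOn ?_ (by rw [hx.1]) (fun s _ => by rw [add_zero]) t ⟨ht, le_rfl⟩
  · rw [gronwallBound_ε0, sub_zero] at h
    linarith
  · intro s hs r hr
    have hs0 := hs.1
    obtain ⟨r', hr1, hr2⟩ := exists_between hr
    have hxs := hx.isSolution_timeShift hs0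
    have h1 := eventually_lt_of_limsup_lt ((hd (histSegment x s)).trans_lt
      (EReal.coe_lt_coe_iff.2 hr1))
    have h2 := (hxs.tendsto_driverStep.const_mul (L : ℝ)).eventually_lt_const
      (show (L : ℝ) * 0 < r - r' by rw [mul_zero]; linarith)
    have h3 : ∀ᶠ h in 𝓝[>] (0 : ℝ),
        h⁻¹ * ((V (histSegment x (s + h)) : ℝ) - V (histSegment x s)) < r := by
      filter_upwards [h1, h2, self_mem_nhdsWithin] with h h1 h2 hh
      have hh : 0 < h := hh
      have h1 := EReal.coe_lt_coe_iff.1 h1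
      have h5 := (abs_le.1 (hV.abs_coe_sub_le (D.driverStep f (histSegment x s) h)
        (histSegment (timeShift x s) h))).1
      rw [histSegment_timeShift x hs0 hh.le] at h2 h5
      rw [div_lt_iff₀ hh] at h1
      rw [← mul_div_assoc, div_lt_iff₀ hh] at h2
      rw [inv_mul_lt_iff₀ hh]
      linarith
    have h4 : Tendsto (fun z => z - s) (𝓝[>] s) (𝓝[>] 0) := by
      refine tendsto_nhdsWithin_iff.2 ⟨?_, ?_⟩
      · have : Tendsto (fun z : ℝ => z - s) (𝓝 s) (𝓝 (s - s)) :=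
          (continuous_id.sub continuous_const).tendsto s
        rw [sub_self] at this
        exact this.mono_left nhdsWithin_le_nhds
      · filter_upwards [self_mem_nhdsWithin] with z hz
        exact mem_Ioi.2 (sub_pos.2 hz)
    refine (h4.eventually h3).frequently.mono fun z hz => ?_
    rwa [add_sub_cancel] at hz

/-! ### From stability to exponential input-output decay -/

theorem Stable.exists_halving_time {D : DifferenceOperator n p Δ} (hD : D.Stable) :
    ∃ T : ℝ, 0 < T ∧ ∀ y, D.IsHomogeneousSolution y →
      ‖histSegment y T‖ ≤ 1 / 2 * ‖histSegment y 0‖ := by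
  obtain ⟨b, hb, h⟩ := hD.2
  obtain ⟨T, -, hT⟩ := h (b / 2) (half_pos hb)
  refine ⟨max T 1, lt_max_of_lt_right one_pos, fun y hy => ?_⟩
  refine le_of_forall_pos_le_add fun ε hε => ?_
  have hs : 0 < ‖histSegment y 0‖ + ε := by positivity
  -- Linearity rescales `y` into the attraction ball of radius `b`, whose solutions reach norm below
  -- `b / 2`. The slack `ε` gives the strict inequality and covers `y_0 = 0`.
  set c := b / (‖histSegment y 0‖ + ε) with hc
  have hc0 : 0 < c := by positivity
  have h1 := hT (c • y) (fun t ht => by rw [histSegment_smul, map_smul, hy t ht, smul_zero]) (by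
    rw [histSegment_smul, norm_smul, Real.norm_of_nonneg hc0.le, hc, div_mul_eq_mul_div,
      div_lt_iff₀ hs]
    nlinarith) (max T 1) (le_max_left _ _)
  rw [histSegment_smul, norm_smul, Real.norm_of_nonneg hc0.le, hc, div_mul_eq_mul_div,
    div_lt_iff₀ hs] at h1
  have h2 : ‖histSegment y (max T 1)‖ < 1 / 2 * (‖histSegment y 0‖ + ε) := by
    refine lt_of_mul_lt_mul_left ?_ hb.le
    linarith
  linarith

/-- A tent supported on `[-r, 0]`, with `r` below all delays, vanishes at every delay point, so `𝒟`
sees only its value at `0`. -/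
theorem exists_rightInverse (D : DifferenceOperator n p Δ) (v : Vec n) :
    ∃ χ : Hist n Δ, ‖χ‖ ≤ ‖v‖ ∧ D.map χ = v := by
  obtain ⟨r, hr, hrd⟩ := D.exists_le_delay
  refine ⟨⟨fun s => max 0 (1 + (s : ℝ) / r) • v, by fun_prop⟩, ?_, ?_⟩
  · refine (ContinuousMap.norm_le _ (norm_nonneg _)).2 fun s => ?_
    have h : (s : ℝ) / r ≤ 0 := div_nonpos_of_nonpos_of_nonneg s.2.2 hr.le
    simp only [ContinuousMap.coe_mk]
    rw [norm_smul, Real.norm_of_nonneg (le_max_left _ _)]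
    exact mul_le_of_le_one_left (norm_nonneg _) (max_le zero_le_one (by linarith))
  · have h : ∀ j, max 0 (1 + -D.delay j / r) = 0 := fun j => max_eq_left (by
      have := (one_le_div hr).2 (hrd j)
      rw [neg_div]
      linarith)
    simp [map, zeroPt, delayPt, h]

/-- The contraction estimate over one halving time for the equation `𝒟 x_t = g(t)`. -/
theorem Stable.exists_step {D : DifferenceOperator n p Δ} (hD : D.Stable) :
    ∃ T B : ℝ, 0 < T ∧ 0 < B ∧ ∀ (x : C(Ici (-Δ), Vec n)) (c : ℝ),
      (∀ t, 0 ≤ t → t ≤ T → ‖D.map (histSegment x t)‖ ≤ c) →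
      ‖histSegment x T‖ ≤ 1 / 2 * ‖histSegment x 0‖ + B * c ∧
      ∀ t, 0 ≤ t → t ≤ T → ‖histSegment x t‖ ≤ B * (‖histSegment x 0‖ + c) := by
  obtain ⟨T, hT, hhalf⟩ := hD.exists_halving_time
  obtain ⟨K, hK, hg⟩ := D.exists_growth_bound (le_refl (0 : ℝ))
  have ha := D.delayGain_nonneg
  set B := 2 * Real.exp (K * T) * (1 + D.delayGain) with hB
  have hB0 : 0 < B := by positivity
  have hgB : ∀ (z : C(Ici (-Δ), Vec n)) (c : ℝ), 0 ≤ c →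
      (∀ t, 0 ≤ t → t ≤ T → ‖D.map (histSegment z t)‖ ≤ c) →
      ∀ t, 0 ≤ t → t ≤ T → ‖histSegment z t‖ ≤ B * (‖histSegment z 0‖ + c) := by
    intro z c hc hz t ht htT
    refine (hg z T c hc (fun s hs hsT => by simpa using hz s hs hsT) t ht htT).trans ?_
    have h1 : c ≤ (1 + D.delayGain) * c := le_mul_of_one_le_left hc (by linarith)
    calc _ ≤ 2 * Real.exp (K * T) * ((1 + D.delayGain) * ‖histSegment z 0‖ +
          (1 + D.delayGain) * c) := by gcongr
      _ = _ := by rw [hB]; ring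
  refine ⟨T, 2 * B + 1 / 2, hT, by positivity, fun x c hx => ?_⟩
  have hc : 0 ≤ c := (norm_nonneg _).trans (hx 0 le_rfl hT.le)
  have hx0 := norm_nonneg (histSegment x 0)
  refine ⟨?_, fun t ht htT => (hgB x c hc hx t ht htT).trans ?_⟩
  -- Correct the initial segment by `χ`, of norm at most `c`, so that it starts a homogeneous
  -- solution `y`. Then `y` halves, costing `c / 2` from `χ`, while `x - y` starts at `χ` and stays
  -- below `2Bc`.
  · obtain ⟨χ, hχ, hχD⟩ := D.exists_rightInverse (D.map (histSegment x 0))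
    obtain ⟨y, hy0, hy⟩ := D.exists_isHomogeneousSolution (ψ := histSegment x 0 - χ)
      (by rw [map_sub, hχD, sub_self])
    have h1 := hgB (x - y) c hc (fun t ht htT => by
      rw [histSegment_sub, map_sub, hy t ht, sub_zero]
      exact hx t ht htT) T hT.le le_rfl
    have h2 := hhalf y hy
    have h3 := hx 0 le_rfl hT.le
    rw [histSegment_sub, histSegment_sub, hy0, sub_sub_cancel] at h1
    rw [hy0] at h2
    have h4 := norm_le_norm_sub_add (histSegment x T) (histSegment y T)
    have h5 := norm_sub_le (histSegment x 0) χ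
    have h6 : B * (‖χ‖ + c) ≤ B * (c + c) :=
      mul_le_mul_of_nonneg_left (by linarith) hB0.le
    linarith
  · exact mul_le_mul_of_nonneg_right (by linarith) (by positivity)

/-- Exponentially decaying inputs of a stable difference operator produce exponentially decaying
outputs. -/
theorem Stable.exists_decay {D : DifferenceOperator n p Δ} (hD : D.Stable) {a : ℝ} (ha : 0 < a) :
    ∃ C lam : ℝ, 0 < C ∧ 0 < lam ∧ ∀ (x : C(Ici (-Δ), Vec n)) (H : ℝ), 0 ≤ H →
      (∀ t, 0 ≤ t → ‖D.map (histSegment x t)‖ ≤ H * Real.exp (-a * t)) →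
      ∀ t, 0 ≤ t → ‖histSegment x t‖ ≤ C * Real.exp (-lam * t) * (‖histSegment x 0‖ + H) := by
  obtain ⟨T, B, hT, hB, hstep⟩ := hD.exists_step
  -- The rate must not exceed that of the input, and one period must shrink by no more than `3/4`,
  -- leaving room above the contraction factor `1/2`.
  obtain ⟨lam, hlam, hlama, hlamT⟩ : ∃ lam : ℝ, 0 < lam ∧ lam ≤ a ∧
      3 / 4 ≤ Real.exp (-lam * T) := by
    refine ⟨min a (1 / (4 * T)), by positivity, min_le_left _ _, ?_⟩
    have h1 : min a (1 / (4 * T)) * T ≤ 1 / 4 := by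
      calc _ ≤ 1 / (4 * T) * T := by gcongr; exact min_le_right _ _
        _ = _ := by field_simp
    have h2 := Real.add_one_le_exp (-min a (1 / (4 * T)) * T)
    linarith
  refine ⟨B * (2 + 4 * B) * Real.exp (lam * T), lam, by positivity, hlam, fun x H hH hx => ?_⟩
  set S := ‖histSegment x 0‖ + H with hS
  have hS0 : 0 ≤ S := by positivity
  have hHS : H ≤ S := by rw [hS]; linarith [norm_nonneg (histSegment x 0)]
  have hin : ∀ (k : ℕ) (t : ℝ), 0 ≤ t →
      ‖D.map (histSegment (timeShift x (k * T)) t)‖ ≤ Real.exp (-lam * (k * T)) * S := by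
    intro k t ht
    have hk : 0 ≤ (k : ℝ) * T := by positivity
    rw [histSegment_timeShift x hk ht]
    refine (hx _ (add_nonneg hk ht)).trans ?_
    have h1 : Real.exp (-a * (k * T + t)) ≤ Real.exp (-lam * (k * T)) := by
      refine Real.exp_le_exp.2 ?_
      nlinarith
    rw [mul_comm]
    exact mul_le_mul h1 hHS hH (Real.exp_pos _).le
  -- The constant `1 + 4B` closes the induction because `(1 + 4B)/2 + B ≤ 3/4 · (1 + 4B)`.
  have hk : ∀ k : ℕ, ‖histSegment x (k * T)‖ ≤ (1 + 4 * B) * (Real.exp (-lam * (k * T)) * S) := by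
    intro k
    induction k with
    | zero =>
      simp only [Nat.cast_zero, zero_mul, mul_zero, Real.exp_zero, one_mul]
      have h1 : 0 ≤ 4 * B * S := by positivity
      linarith
    | succ k ih =>
      have hkT : 0 ≤ (k : ℝ) * T := by positivity
      have h1 := (hstep (timeShift x (k * T)) _ fun t ht _ => hin k t ht).1
      rw [histSegment_timeShift x hkT hT.le, histSegment_timeShift x hkT le_rfl, add_zero] at h1
      have h2 : Real.exp (-lam * (((k + 1 : ℕ) : ℝ) * T)) =
          Real.exp (-lam * T) * Real.exp (-lam * (k * T)) := by
        rw [← Real.exp_add]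
        push_cast
        ring_nf
      have h3 : ((k + 1 : ℕ) : ℝ) * T = k * T + T := by push_cast; ring
      rw [h2, h3]
      set E := Real.exp (-lam * (k * T)) * S with hE
      have hE0 : 0 ≤ E := by positivity
      have h4 : 3 / 4 * ((1 + 4 * B) * E) ≤ Real.exp (-lam * T) * ((1 + 4 * B) * E) :=
        mul_le_mul_of_nonneg_right hlamT (by positivity)
      rw [mul_assoc (Real.exp (-lam * T)), ← hE]
      linarith
  intro t ht
  set k := ⌊t / T⌋₊ with hkdef
  have hk1 : (k : ℝ) * T ≤ t := (le_div_iff₀ hT).1 (Nat.floor_le (by positivity))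
  have hk2 : t < (k + 1) * T := (div_lt_iff₀ hT).1 (Nat.lt_floor_add_one _)
  have hkT : 0 ≤ (k : ℝ) * T := by positivity
  have h1 := (hstep (timeShift x (k * T)) _ fun t ht _ => hin k t ht).2 (t - k * T) (by linarith)
    (by linarith)
  rw [histSegment_timeShift x hkT (by linarith), histSegment_timeShift x hkT le_rfl, add_zero,
    add_sub_cancel] at h1
  have h2 : Real.exp (-lam * (k * T)) ≤ Real.exp (lam * T) * Real.exp (-lam * t) := by
    rw [← Real.exp_add]
    refine Real.exp_le_exp.2 ?_
    nlinarith
  calc _ ≤ B * (‖histSegment x (k * T)‖ + Real.exp (-lam * (k * T)) * S) := h1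
    _ ≤ B * ((1 + 4 * B) * (Real.exp (-lam * (k * T)) * S) + Real.exp (-lam * (k * T)) * S) := by
        have := hk k
        gcongr
    _ = B * (2 + 4 * B) * S * Real.exp (-lam * (k * T)) := by ring
    _ ≤ B * (2 + 4 * B) * S * (Real.exp (lam * T) * Real.exp (-lam * t)) := by gcongr
    _ = _ := by ring

/-! ### Sufficiency of the Lyapunov conditions -/

theorem isZeroGES_of_lyapunov {D : DifferenceOperator n p Δ} (hD : D.Stable)
    {f : Hist n Δ → Vec n} {Lf : ℝ≥0} (hf : LipschitzWith Lf f) (hf0 : f 0 = 0)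
    {V : Hist n Δ → ℝ≥0} {L : ℝ≥0} (hV : LipschitzWith L V) {a₁ a₂ a₃ : ℝ} (h₁ : 0 < a₁)
    (h₂ : 0 < a₂) (h₃ : 0 < a₃) (hlower : ∀ φ, a₁ * ‖D.map φ‖ ≤ (V φ : ℝ))
    (hupper : ∀ φ, (V φ : ℝ) ≤ a₂ * ‖φ‖)
    (hd : ∀ φ, D.driverDeriv f V φ ≤ ((-a₃ * (V φ : ℝ) : ℝ) : EReal)) : D.IsZeroGES f := by
  obtain ⟨C, lam, hC, hlam, h⟩ := hD.exists_decay h₃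
  refine ⟨C * (1 + a₂ / a₁), lam, by positivity, hlam, fun ξ =>
    ⟨D.exists_isSolution hf hf0 ξ, fun x hx t ht => ?_⟩⟩
  have h1 := h x (a₂ / a₁ * ‖ξ‖) (by positivity) (fun s hs => ?_) t ht
  · refine (norm_apply_le_norm_histSegment x ht t (by linarith [D.maxDelay_pos]) le_rfl).trans
      (h1.trans_eq ?_)
    rw [hx.1]
    ring
  · have h2 := hx.decay_of_driverDeriv_le hV hd hs
    have h3 := hlower (histSegment x s)
    have h4 := mul_le_mul_of_nonneg_left (hupper ξ) (Real.exp_pos (-a₃ * s)).le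
    rw [div_mul_eq_mul_div, div_mul_eq_mul_div, le_div_iff₀ h₁]
    linarith

/-! ### The converse Lyapunov functional -/

theorem IsZeroGES.exists_histSegment_bound {D : DifferenceOperator n p Δ} {f : Hist n Δ → Vec n}
    (h : D.IsZeroGES f) : ∃ M lam : ℝ, 1 ≤ M ∧ 0 < lam ∧ ∀ (ξ : Hist n Δ) (x : C(Ici (-Δ), Vec n)),
      D.IsSolution f ξ x → ∀ t, 0 ≤ t → ‖histSegment x t‖ ≤ M * Real.exp (-lam * t) * ‖ξ‖ := by
  obtain ⟨M, lam, hM, hlam, h⟩ := h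
  have hΔ := D.maxDelay_pos
  -- A segment looks back by `Δ`, which costs `e^{λΔ}`. The maximum with `1` covers the part still
  -- lying in the initial history.
  refine ⟨max M 1 * Real.exp (lam * Δ), lam,
    one_le_mul_of_one_le_of_one_le (le_max_right _ _) (Real.one_le_exp (by positivity)), hlam,
    fun ξ x hx t ht => ?_⟩
  have h0 : max M 1 * Real.exp (lam * Δ) * Real.exp (-lam * t) * ‖ξ‖ =
      max M 1 * Real.exp (-lam * (t - Δ)) * ‖ξ‖ := by
    rw [mul_assoc (max M 1), ← Real.exp_add]
    ring_nf
  rw [h0]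
  refine histSegment_norm_le ht (by positivity) fun u hu hut => ?_
  rcases le_total 0 (u : ℝ) with hu0 | hu0
  · refine ((h ξ).2 x hx u hu0).trans ?_
    have h1 : -lam * u ≤ -lam * (t - Δ) := by nlinarith
    gcongr
    exact le_max_left _ _
  · have h1 := norm_apply_le_norm_histSegment x le_rfl u
      (by have := u.2; simp only [mem_Ici] at this; linarith) hu0
    rw [hx.1] at h1
    refine h1.trans (le_mul_of_one_le_left (norm_nonneg _) ?_)
    refine one_le_mul_of_one_le_of_one_le (le_max_right _ _) (Real.one_le_exp ?_)
    nlinarith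

/-- The functional dominates the full norm `‖φ‖`, taking `t = 0` in the supremum; this is stronger
than domination of `‖𝒟 φ‖` and also drives the Lipschitz estimate. -/
theorem IsZeroGES.exists_lyapunov {D : DifferenceOperator n p Δ} {f : Hist n Δ → Vec n} {Lf : ℝ≥0}
    (hf : LipschitzWith Lf f) (h : D.IsZeroGES f) :
    ∃ V : Hist n Δ → ℝ≥0, (∃ L : ℝ≥0, LipschitzWith L V) ∧ ∃ a₂ a₃ : ℝ, 0 < a₂ ∧ 0 < a₃ ∧
      ∀ φ : Hist n Δ, ‖φ‖ ≤ V φ ∧ (V φ : ℝ) ≤ a₂ * ‖φ‖ ∧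
        D.driverDeriv f V φ ≤ ((-a₃ * (V φ : ℝ) : ℝ) : EReal) := by
  obtain ⟨M, lam, hM, hlam, hb⟩ := h.exists_histSegment_bound
  obtain ⟨G, K, hG, hK, hflow⟩ := D.exists_flow_bound hf
  choose S hS using fun ξ => (h.choose_spec.choose_spec.2.2 ξ).1
  -- Half the rate leaves a spare factor `e^{-μt}`, which makes late times negligible in the
  -- supremum.
  set μ := lam / 2 with hμ
  have hμ0 : 0 < μ := half_pos hlam
  set g : Hist n Δ → ℝ≥0 → ℝ := fun φ t => Real.exp (μ * t) * ‖histSegment (S φ) t‖ with hg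
  have hgb : ∀ φ (t : ℝ≥0), g φ t ≤ M * Real.exp (-(μ * t)) * ‖φ‖ := fun φ t => by
    have h1 := mul_le_mul_of_nonneg_left (hb φ (S φ) (hS φ) t t.coe_nonneg) (Real.exp_pos (μ * t)).le
    refine h1.trans_eq ?_
    have h2 : Real.exp (-(μ * t)) = Real.exp (μ * t) * Real.exp (-lam * t) := by
      rw [← Real.exp_add, hμ]
      ring_nf
    rw [h2]
    ring
  have hgM : ∀ φ (t : ℝ≥0), g φ t ≤ M * ‖φ‖ := fun φ t => by
    refine (hgb φ t).trans ?_
    have h1 : Real.exp (-(μ * t)) ≤ 1 := Real.exp_le_one_iff.2 (by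
      have := mul_nonneg hμ0.le t.coe_nonneg
      linarith)
    have := mul_le_mul_of_nonneg_left h1 (show 0 ≤ M * ‖φ‖ by positivity)
    linarith
  have hbdd : ∀ φ, BddAbove (range (g φ)) := fun φ => ⟨M * ‖φ‖, by
    rintro _ ⟨t, rfl⟩
    exact hgM φ t⟩
  have hg0 : ∀ φ, g φ 0 = ‖φ‖ := fun φ => by
    simp [hg, (hS φ).1]
  set W : Hist n Δ → ℝ := fun φ => ⨆ t, g φ t with hW
  have hgW : ∀ φ t, g φ t ≤ W φ := fun φ t => le_ciSup (hbdd φ) t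
  have hφW : ∀ φ, ‖φ‖ ≤ W φ := fun φ => (hg0 φ).symm.trans_le (hgW φ 0)
  have hW0 : ∀ φ, 0 ≤ W φ := fun φ => (norm_nonneg φ).trans (hφW φ)
  -- Beyond `T` the weighted norm is at most `‖φ‖ ≤ ‖ψ‖ + ‖φ - ψ‖ ≤ W ψ + ‖φ - ψ‖`, so the flow
  -- bound is needed only on `[0, T]`. These two ranges account for the two summands of `L`.
  obtain ⟨T, hT0, hT⟩ : ∃ T : ℝ, 0 ≤ T ∧ M * Real.exp (-(μ * T)) ≤ 1 := by
    refine ⟨Real.log M / μ, div_nonneg (Real.log_nonneg hM) hμ0.le, ?_⟩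
    rw [mul_div_cancel₀ _ hμ0.ne', Real.exp_neg, Real.exp_log (by linarith),
      mul_inv_cancel₀ (by linarith)]
  set L : ℝ := 1 + Real.exp (μ * T) * (G * Real.exp (K * T)) with hL
  have hL0 : 0 ≤ L := by positivity
  have hlip : ∀ φ ψ, W φ ≤ W ψ + L * ‖φ - ψ‖ := fun φ ψ => by
    refine ciSup_le fun t => ?_
    have hLe : L * ‖φ - ψ‖ = ‖φ - ψ‖ + Real.exp (μ * T) * (G * Real.exp (K * T)) * ‖φ - ψ‖ := by
      rw [hL]
      ring
    rcases le_total (t : ℝ) T with ht | ht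
    · have h1 := hflow φ ψ (S φ) (S ψ) (hS φ) (hS ψ) t t.coe_nonneg
      have h2 := norm_le_norm_sub_add (histSegment (S φ) t) (histSegment (S ψ) t)
      have h3 : g φ t ≤ Real.exp (μ * t) * (G * Real.exp (K * t) * ‖φ - ψ‖) + g ψ t := by
        rw [hg]
        simp only
        rw [← mul_add]
        exact mul_le_mul_of_nonneg_left (by linarith) (Real.exp_pos _).le
      have h4 : Real.exp (μ * t) * (G * Real.exp (K * t) * ‖φ - ψ‖) ≤
          Real.exp (μ * T) * (G * Real.exp (K * T) * ‖φ - ψ‖) := by gcongr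
      have h5 := hgW ψ t
      have h6 := norm_nonneg (φ - ψ)
      linarith
    · have h1 : M * Real.exp (-(μ * t)) ≤ 1 := by
        refine le_trans ?_ hT
        gcongr
      have h2 := (hgb φ t).trans (mul_le_of_le_one_left (norm_nonneg _) h1)
      have h3 := norm_le_norm_sub_add φ ψ
      have h4 := hφW ψ
      have h5 : 0 ≤ Real.exp (μ * T) * (G * Real.exp (K * T)) * ‖φ - ψ‖ := by positivity
      linarith
  obtain ⟨V, hVW⟩ : ∃ V : Hist n Δ → ℝ≥0, ∀ φ, (V φ : ℝ) = W φ :=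
    ⟨fun φ => (W φ).toNNReal, fun φ => Real.coe_toNNReal _ (hW0 φ)⟩
  have hV : LipschitzWith L.toNNReal V := by
    refine LipschitzWith.of_dist_le_mul fun φ ψ => ?_
    rw [NNReal.dist_eq, dist_eq_norm, hVW, hVW, Real.coe_toNNReal _ hL0]
    have h1 := hlip φ ψ
    have h2 := hlip ψ φ
    rw [norm_sub_rev] at h2
    exact abs_sub_le_iff.2 ⟨by linarith, by linarith⟩
  refine ⟨V, ⟨_, hV⟩, M, μ, by linarith, hμ0, fun φ => ⟨(hφW φ).trans_eq (hVW φ).symm,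
    (hVW φ).trans_le (ciSup_le fun t => hgM φ t), ?_⟩⟩
  refine (hS φ).driverDeriv_le hV fun s hs => ?_
  rw [hVW, hVW]
  refine ciSup_le fun t => ?_
  -- By uniqueness the chosen solution from `x_s` is the shifted one. Its supremum is thus `e^{-μs}`
  -- times a supremum over times at least `s`.
  have h1 := (hS (histSegment (S φ) s)).histSegment_eq hf ((hS φ).isSolution_timeShift hs)
    t.coe_nonneg
  lift s to ℝ≥0 using hs
  have h2 := hgW φ (s + t)
  have h3 : Real.exp (μ * t) = Real.exp (-(μ * s)) * Real.exp (μ * (s + t)) := by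
    rw [← Real.exp_add]
    ring_nf
  rw [hg]
  simp only
  rw [h1, histSegment_timeShift _ s.coe_nonneg t.coe_nonneg, h3, mul_assoc]
  exact mul_le_mul_of_nonneg_left h2 (Real.exp_pos _).le

end DifferenceOperator

theorem mainTheorem3 {n p : ℕ} (hn : 0 < n) (hp : 0 < p) {Δ : ℝ}
    (D : DifferenceOperator n p Δ) (hD : D.StronglyStable)
    (f : Hist n Δ → Vec n) (hf0 : f 0 = 0) (hf : ∃ L : ℝ≥0, LipschitzWith L f) :
    D.IsZeroGES f ↔
      ∃ V : Hist n Δ → ℝ≥0, (∃ L : ℝ≥0, LipschitzWith L V) ∧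
        ∃ a₁ a₂ a₃ : ℝ, 0 < a₁ ∧ 0 < a₂ ∧ 0 < a₃ ∧ ∀ φ : Hist n Δ,
          (a₁ * ‖D.map φ‖ ≤ (V φ : ℝ) ∧ (V φ : ℝ) ≤ a₂ * ‖φ‖) ∧
          D.driverDeriv f V φ ≤ ((-a₃ * (V φ : ℝ) : ℝ) : EReal) := by
  obtain ⟨Lf, hf⟩ := hf
  constructor
  · intro h
    obtain ⟨V, hV, a₂, a₃, h₂, h₃, h⟩ := h.exists_lyapunov hf
    have ha : 0 < 1 + D.delayGain := by have := D.delayGain_nonneg; positivity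
    refine ⟨V, hV, (1 + D.delayGain)⁻¹, a₂, a₃, by positivity, h₂, h₃, fun φ =>
      ⟨⟨?_, (h φ).2.1⟩, (h φ).2.2⟩⟩
    exact ((inv_mul_le_iff₀ ha).2 (D.norm_map_le φ)).trans (h φ).1
  · rintro ⟨V, ⟨L, hV⟩, a₁, a₂, a₃, h₁, h₂, h₃, h⟩
    -- Strong stability is applied with the delays of `D` itself.
    exact D.isZeroGES_of_lyapunov (hD Δ D rfl) hf hf0 hV h₁ h₂ h₃ (fun φ => (h φ).1.1)
      (fun φ => (h φ).1.2) fun φ => (h φ).2
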